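/- Let $\mathbb{S}$ be a simplicially enriched category, possibly large, with mapping spaces $\mathrm{Map}(x,y)\in\mathbf{sSet}$. Suppose that $\mathbb{S}$ is Kan complex enriched: for all objects $x,y$, every horn $\Lambda^m_k\to\mathrm{Map}(x,y)$ with $m\ge 1$ and $0\le k\le m$ extends along $\Lambda^m_k\hookrightarrow\Delta^m$. For $n\ge 0$ let $\mathfrak{C}[n]$ be the homotopy coherent $n$-simplex. This is the simplicial category with objects $0,1,\dots,n$ in which $\mathfrak{C}[n](i,j)$ is the nerve of the poset of subsets $T$ with $\{i,j\}\subseteq T\subseteq\{t: i\le t\le j\}$, ordered by inclusion (so it is empty if $i>j$). Composition is induced by union of subsets, and the identity at $i$ is $\{i\}$. An order-preserving map $\alpha\colon[m]\to[n]$ induces a simplicial functor $\mathfrak{C}[m]\to\mathfrak{C}[n]$, given by $\alpha$ on objects and by $T\mapsto\alpha(T)$ on mapping spaces. The homotopy coherent nerve $\mathfrak{N}\mathbb{S}$ is the simplicial set whose $n$-simplices are the simplicial functors $\mathfrak{C}[n]\to\mathbb{S}$, with simplicial operators acting by precomposition. Then $\mathfrak{N}\mathbb{S}$ is a quasi-category: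 for all $0<k<n$, every map $\Lambda^n_k\to\mathfrak{N}\mathbb{S}$ extends along the inner horn inclusion $\Lambda^n_k\hookrightarrow\Delta^n$. -/

import Mathlib

universe v u

/-!
A map from an inner horn `Λ[n, i]` to the homotopy coherent nerve of `S` is a family of simplicial
functors defined on the faces of the horn, and filling the horn means extending them to a
simplicial functor on the simplicial thickening of `J = {0, …, n}`.

For `(p, q) ≠ (0, n)`, the mapping space from `p` to `q` is contained in the face
opposite to `0` or in the face opposite to `n`, and both of these faces belong to an inner horn. So
the functor is already determined there, and only the mapping space from `0` to `n` remains. It is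
a cube with one coordinate for each vertex `j` strictly between `0` and `n`, which records whether
`j` belongs to a subset. The faces of the horn prescribe the functor where some `j ≠ i` is missing,
and compatibility with composition prescribes it where some `j` is present throughout. Together
these are all the faces of the cube but one (`openBox`).

The inclusion of this open box into the cube is anodyne (`anodyneExtensions_openBox_ι`): it is a
retract of the pushout-product of the vertex inclusion `{1} ⟶ Δ[1]`, in the direction `i`, and the
inclusion of the faces in the other directions. Hence the prescribed map extends to the cube, as
the mapping spaces of `S` are Kan complexes.

The gluing is done on simplices. Instead of the faces of the horn, only the simplices of `Λ[n, i]`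
that are monotone endomorphisms of `J` are used (`HornDiagram`); each face is a restriction of one
of them. The prescribed value on a simplex is described by a relation (`HornDiagram.Val`) that is
stable under the simplicial operators. That it is functional (`HornDiagram.Val.unique`) follows
from two facts: the value given by an endomorphism `f` depends only on the elements that occur in
the simplex (`HornDiagram.act_congr`), and two decompositions of a simplex have a common refinement
(`exists_common_refinement`).
-/

open CategoryTheory MonoidalCategory Simplicial Opposite HomotopicalAlgebra

/-! ### Simplices of the mapping spaces of a simplicial category -/

namespace CategoryTheory.SimplicialCategory

section Elements

variable {D : Type u} [EnrichedCategory SSet.{v} D] {n m : SimplexCategoryᵒᵖ}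

/-- The `n`-simplex of a product of simplicial sets with the given components. -/
abbrev pairSimplex {A B : SSet.{v}} (s : A.obj n) (t : B.obj n) : (A ⊗ B).obj n :=
  ⟨s, t⟩

/-- The composite of two `n`-simplices of mapping spaces. For a fixed `n`, the `n`-simplices of
the mapping spaces are the morphisms of a category, with this composition. -/
def compSimplex {x y z : D} (s : (x ⟶[SSet.{v}] y).obj n) (t : (y ⟶[SSet.{v}] z).obj n) :
    (x ⟶[SSet.{v}] z).obj n :=
  (eComp SSet.{v} x y z).app n (pairSimplex s t)

/-- The `n`-simplex of the mapping space from `x` to itself that is degenerate on the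
identity. -/
def idSimplex (x : D) (n : SimplexCategoryᵒᵖ) : (x ⟶[SSet.{v}] x).obj n :=
  (eId SSet.{v} x).app n PUnit.unit

lemma map_compSimplex (θ : n ⟶ m) {x y z : D} (s : (x ⟶[SSet.{v}] y).obj n)
    (t : (y ⟶[SSet.{v}] z).obj n) :
    (x ⟶[SSet.{v}] z).map θ (compSimplex s t) =
      compSimplex ((x ⟶[SSet.{v}] y).map θ s) ((y ⟶[SSet.{v}] z).map θ t) :=
  (NatTrans.naturality_apply (eComp SSet.{v} x y z) θ (pairSimplex s t :)).symm

lemma idSimplex_comp {x y : D} (s : (x ⟶[SSet.{v}] y).obj n) :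
    compSimplex (idSimplex x n) s = s :=
  ConcreteCategory.congr_hom (NatTrans.congr_app (e_id_comp SSet.{v} x y) n) s

lemma comp_idSimplex {x y : D} (s : (x ⟶[SSet.{v}] y).obj n) :
    compSimplex s (idSimplex y n) = s :=
  ConcreteCategory.congr_hom (NatTrans.congr_app (e_comp_id SSet.{v} x y) n) s

lemma compSimplex_assoc {w x y z : D} (s : (w ⟶[SSet.{v}] x).obj n)
    (t : (x ⟶[SSet.{v}] y).obj n) (r : (y ⟶[SSet.{v}] z).obj n) :
    compSimplex (compSimplex s t) r = compSimplex s (compSimplex t r) :=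
  ConcreteCategory.congr_hom (NatTrans.congr_app (e_assoc SSet.{v} w x y z) n)
    (pairSimplex s (pairSimplex t r :) :)

end Elements

section Functors

variable {C : Type*} [EnrichedCategory SSet.{v} C] {D : Type u} [EnrichedCategory SSet.{v} D]

/-- Constructor for simplicial functors, with the axioms stated on simplices. -/
def enrichedFunctorMk (obj : C → D)
    (map : ∀ x y : C, (x ⟶[SSet.{v}] y) ⟶ (obj x ⟶[SSet.{v}] obj y))
    (hid : ∀ (x : C) (n : SimplexCategoryᵒᵖ),
      (map x x).app n (idSimplex x n) = idSimplex (obj x) n)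
    (hcomp : ∀ (x y z : C) (n : SimplexCategoryᵒᵖ) (s : (x ⟶[SSet.{v}] y).obj n)
      (t : (y ⟶[SSet.{v}] z).obj n), (map x z).app n (compSimplex s t) =
        compSimplex ((map x y).app n s) ((map y z).app n t)) :
    EnrichedFunctor SSet.{v} C D where
  obj := obj
  map := map
  map_id x := by
    ext n ⟨⟩
    exact hid x n
  map_comp x y z := by
    ext n ⟨s, t⟩
    exact hcomp x y z n s t

/-- The action of a simplicial functor on a mapping space, with a codomain whose endpoints are
only propositionally the images of the given objects. All transports along equalities of objects
are confined to this definition. -/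
def mapOfEq (F : EnrichedFunctor SSet.{v} C D) {c d : C} {x y : D}
    (hc : F.obj c = x) (hd : F.obj d = y) : (c ⟶[SSet.{v}] d) ⟶ (x ⟶[SSet.{v}] y) :=
  F.map c d ≫ eqToHom (by rw [hc, hd])

lemma mapOfEq_idSimplex (F : EnrichedFunctor SSet.{v} C D) {c : C} {x : D}
    (hc hc' : F.obj c = x) (n : SimplexCategoryᵒᵖ) :
    (mapOfEq F hc hc').app n (idSimplex c n) = idSimplex x n := by
  subst hc
  rw [mapOfEq, eqToHom_refl, Category.comp_id]
  exact ConcreteCategory.congr_hom (NatTrans.congr_app (F.map_id c) n) PUnit.unit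

lemma mapOfEq_compSimplex (F : EnrichedFunctor SSet.{v} C D) {c d e : C} {x y z : D}
    (hc : F.obj c = x) (hd : F.obj d = y) (he : F.obj e = z) {n : SimplexCategoryᵒᵖ}
    (s : (c ⟶[SSet.{v}] d).obj n) (t : (d ⟶[SSet.{v}] e).obj n) :
    (mapOfEq F hc he).app n (compSimplex s t) =
      compSimplex ((mapOfEq F hc hd).app n s) ((mapOfEq F hd he).app n t) := by
  subst hc hd he
  simp only [mapOfEq, eqToHom_refl, Category.comp_id]
  exact ConcreteCategory.congr_hom (NatTrans.congr_app (F.map_comp c d e) n) (pairSimplex s t :)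

lemma mapOfEq_comp {B : Type*} [EnrichedCategory SSet.{v} B]
    {K : EnrichedFunctor SSet.{v} B D} {F : EnrichedFunctor SSet.{v} B C}
    {G : EnrichedFunctor SSet.{v} C D} (h : K = F.comp SSet.{v} G) {c d : B} {x y : D}
    (hc : K.obj c = x) (hd : K.obj d = y) (hc' : G.obj (F.obj c) = x)
    (hd' : G.obj (F.obj d) = y) :
    mapOfEq K hc hd = F.map c d ≫ mapOfEq G hc' hd' := by
  subst h hc' hd'
  simp only [mapOfEq, eqToHom_refl, Category.comp_id]
  exact Category.comp_id _

end Functors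

end CategoryTheory.SimplicialCategory

/-! ### Simplices of the mapping spaces of the simplicial thickening -/

namespace CategoryTheory.SimplicialThickening
open SimplicialCategory

variable {J : Type v} [LinearOrder J]

section Chains

variable {n : SimplexCategoryᵒᵖ} {a b c : SimplicialThickening J}

/-- An `n`-simplex of the mapping space from `a` to `b` in the simplicial thickening of `J` is an
increasing sequence of subsets of `[a, b]` containing `a` and `b`; this is its `l`-th term. -/
def chain (t : (a ⟶[SSet.{v}] b).obj n) (l : Fin (n.unop.len + 1)) : Set J :=
  ((show ComposableArrows (a ⟶ b) n.unop.len from t).obj l).I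

@[ext]
lemma chain_ext {s t : (a ⟶[SSet.{v}] b).obj n} (h : ∀ l, chain s l = chain t l) : s = t := by
  have : Quiver.IsThin (a ⟶ b) := fun x y ↦ ⟨fun f g ↦ by
    apply InducedCategory.hom_ext; subsingleton⟩
  exact nerve.ext_of_isThin (C := a ⟶ b) (funext fun l ↦ Path.ext (h l))

lemma chain_mono (t : (a ⟶[SSet.{v}] b).obj n) : Monotone (chain t) :=
  fun _ _ h ↦ ((show ComposableArrows (a ⟶ b) n.unop.len from t).map (homOfLE h)).1.1.1

lemma left_mem_chain (t : (a ⟶[SSet.{v}] b).obj n) (l) : a.as ∈ chain t l :=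
  ((show ComposableArrows (a ⟶ b) n.unop.len from t).obj l).left

lemma right_mem_chain (t : (a ⟶[SSet.{v}] b).obj n) (l) : b.as ∈ chain t l :=
  ((show ComposableArrows (a ⟶ b) n.unop.len from t).obj l).right

lemma left_le_of_mem_chain {t : (a ⟶[SSet.{v}] b).obj n} {l} {j : J} (h : j ∈ chain t l) :
    a.as ≤ j :=
  ((show ComposableArrows (a ⟶ b) n.unop.len from t).obj l).left_le j h

lemma le_right_of_mem_chain {t : (a ⟶[SSet.{v}] b).obj n} {l} {j : J} (h : j ∈ chain t l) :
    j ≤ b.as :=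
  ((show ComposableArrows (a ⟶ b) n.unop.len from t).obj l).le_right j h

/-- The simplex given by an increasing sequence of subsets of `[a, b]` containing `a` and `b`. -/
def mkChain (T : Fin (n.unop.len + 1) → Set J) (hT : Monotone T) (ha : ∀ l, a.as ∈ T l)
    (hb : ∀ l, b.as ∈ T l) (h : ∀ l, ∀ j ∈ T l, a.as ≤ j ∧ j ≤ b.as) :
    (a ⟶[SSet.{v}] b).obj n :=
  show Fin (n.unop.len + 1) ⥤ (a ⟶ b) from
  { obj l := ⟨T l, ha l, hb l, fun j hj ↦ (h l j hj).1, fun j hj ↦ (h l j hj).2⟩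
    map f := ⟨⟨⟨hT (leOfHom f)⟩⟩⟩ }

@[simp]
lemma chain_compSimplex (s : (a ⟶[SSet.{v}] b).obj n) (t : (b ⟶[SSet.{v}] c).obj n) (l) :
    chain (compSimplex s t) l = chain s l ∪ chain t l := rfl

end Chains

/-! ### Monotone endomorphisms factoring through a horn -/

section Order

/-- The retraction sends `k` to the greatest element of `T` below `k`, or to the least element of
`T` if there is none. -/
lemma exists_monotone_retraction [Finite J] (T : Set J) (hT : T.Nonempty) :
    ∃ ρ : J →o J, (∀ j ∈ T, ρ j = j) ∧ ∀ j, ρ j ∈ T := by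
  obtain ⟨m, hm, hmin⟩ := Set.exists_min_image T id T.toFinite hT
  have key (k : J) : ∃ r, IsGreatest (T ∩ Set.Iic (max k m)) r := by
    obtain ⟨r, hr, hmax⟩ := Set.exists_max_image (T ∩ Set.Iic (max k m)) id (Set.toFinite _)
      ⟨m, hm, le_max_right _ _⟩
    exact ⟨r, hr, hmax⟩
  choose r hr using key
  refine ⟨⟨r, fun k l hkl ↦ (hr k).mono (hr l)
    fun j hj ↦ ⟨hj.1, hj.2.trans (max_le_max_right _ hkl)⟩⟩, fun j hj ↦ ?_, fun j ↦ (hr j).1.1⟩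
  refine le_antisymm ?_ ((hr j).2 ⟨hj, le_max_left _ _⟩)
  exact (hr j).1.2.trans (max_le le_rfl (hmin j hj))

/-- The monotone endomorphism `f` misses some element other than `i`. For `J = {0, …, n}` this
says that `f`, seen as an `n`-simplex of `Δ[n]`, belongs to the horn `Λ[n, i]`. -/
def InHorn (i : J) (f : J →o J) : Prop := ∃ j, j ≠ i ∧ ∀ k, f k ≠ j

lemma InHorn.comp {i : J} {f : J →o J} (hf : InHorn i f) (g : J →o J) : InHorn i (f.comp g) := by
  obtain ⟨j, hj, h⟩ := hf
  exact ⟨j, hj, fun k ↦ h _⟩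

lemma inHorn_const [BoundedOrder J] {i : J} (h₀ : ⊥ < i) (h₁ : i < ⊤) (j : J) :
    InHorn i (OrderHom.const J j) := by
  by_cases hj : j = ⊥
  · exact ⟨⊤, h₁.ne', fun _ h ↦ (h₀.trans h₁).ne (hj.symm.trans h)⟩
  · exact ⟨⊥, h₀.ne, fun _ h ↦ hj h⟩

end Order

/-! ### Decompositions of simplices of the simplicial thickening -/

lemma le_of_simplex {n : SimplexCategoryᵒᵖ} {p q : SimplicialThickening J}
    (t : (p ⟶[SSet.{v}] q).obj n) : p.as ≤ q.as :=
  left_le_of_mem_chain (right_mem_chain t 0)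

lemma eq_idSimplex {n : SimplexCategoryᵒᵖ} {p : SimplicialThickening J}
    (t : (p ⟶[SSet.{v}] p).obj n) : t = idSimplex p n := by
  refine chain_ext fun l ↦ Set.Subset.antisymm (fun j hj ↦ ?_) ?_
  · exact le_antisymm (le_right_of_mem_chain hj) (left_le_of_mem_chain hj)
  · rintro _ rfl
    exact left_mem_chain t l

/-- The image of a simplex under the simplicial functor induced by `f`. The endpoints are stated
as `f p.as` and `f q.as`, to which the values of the functor on objects reduce by unfolding. -/
def image (f : J →o J) {n : SimplexCategoryᵒᵖ} {p q : SimplicialThickening J}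
    (t : (p ⟶[SSet.{v}] q).obj n) :
    ((.mk (f p.as) : SimplicialThickening J) ⟶[SSet.{v}] .mk (f q.as)).obj n :=
  ((functor f).map p q).app n t

@[simp]
lemma chain_image (f : J →o J) {n : SimplexCategoryᵒᵖ} {p q : SimplicialThickening J}
    (t : (p ⟶[SSet.{v}] q).obj n) (l) : chain (image f t) l = f '' chain t l := rfl

/-- The simplex `t` cut down to the interval `[r, r']`, where `r` and `r'` belong to all terms
of `t`. -/
def restrict {n : SimplexCategoryᵒᵖ} {p q : SimplicialThickening J}
    (t : (p ⟶[SSet.{v}] q).obj n) (r r' : SimplicialThickening J) (hrr' : r.as ≤ r'.as)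
    (hr : ∀ l, r.as ∈ chain t l) (hr' : ∀ l, r'.as ∈ chain t l) : (r ⟶[SSet.{v}] r').obj n :=
  mkChain (fun l ↦ chain t l ∩ Set.Icc r.as r'.as)
    (fun _ _ h ↦ Set.inter_subset_inter_left _ (chain_mono t h))
    (fun l ↦ ⟨hr l, le_rfl, hrr'⟩) (fun l ↦ ⟨hr' l, hrr', le_rfl⟩) (fun _ _ h ↦ h.2)

@[simp]
lemma chain_restrict {n : SimplexCategoryᵒᵖ} {p q : SimplicialThickening J}
    (t : (p ⟶[SSet.{v}] q).obj n) (r r' : SimplicialThickening J) (hrr' : r.as ≤ r'.as)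
    (hr : ∀ l, r.as ∈ chain t l) (hr' : ∀ l, r'.as ∈ chain t l) (l) :
    chain (restrict t r r' hrr' hr hr') l = chain t l ∩ Set.Icc r.as r'.as := rfl

lemma compSimplex_restrict {n : SimplexCategoryᵒᵖ} {p q : SimplicialThickening J}
    (t : (p ⟶[SSet.{v}] q).obj n) (r : SimplicialThickening J) (hpr : p.as ≤ r.as)
    (hrq : r.as ≤ q.as) (hr : ∀ l, r.as ∈ chain t l) :
    compSimplex (restrict t p r hpr (left_mem_chain t) hr)
      (restrict t r q hrq hr (right_mem_chain t)) = t := by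
  ext l j
  have h₁ := @left_le_of_mem_chain _ _ _ _ _ t l j
  have h₂ := @le_right_of_mem_chain _ _ _ _ _ t l j
  have := le_total j r.as
  simp only [chain_compSimplex, chain_restrict, Set.mem_union, Set.mem_inter_iff, Set.mem_Icc]
  tauto

/-- Two decompositions of a simplex, at `r` and at `r' ≥ r`, have a common refinement into three
pieces. -/
lemma exists_common_refinement {n : SimplexCategoryᵒᵖ} {p q r r' : SimplicialThickening J}
    {u : (p ⟶[SSet.{v}] r).obj n} {v : (r ⟶[SSet.{v}] q).obj n}
    {u' : (p ⟶[SSet.{v}] r').obj n} {v' : (r' ⟶[SSet.{v}] q).obj n}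
    (h : compSimplex u v = compSimplex u' v') (hrr' : r.as ≤ r'.as) :
    ∃ w : (r ⟶[SSet.{v}] r').obj n, u' = compSimplex u w ∧ v = compSimplex w v' := by
  have key (l) (j) : (j ∈ chain u l ∨ j ∈ chain v l) ↔ (j ∈ chain u' l ∨ j ∈ chain v' l) := by
    have := congrArg (fun t ↦ j ∈ chain t l) h
    simpa using this
  have hr (l) : r.as ∈ chain (compSimplex u v) l := Or.inl (right_mem_chain u l)
  have hr' (l) : r'.as ∈ chain (compSimplex u v) l := (key l _).2 (Or.inl (right_mem_chain u' l))
  refine ⟨restrict (compSimplex u v) r r' hrr' hr hr', ?_, ?_⟩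
  all_goals
    ext l j
    have h₁ := right_mem_chain u l
    have h₂ := right_mem_chain u' l
    have h₃ := left_mem_chain v l
    have h₄ := left_mem_chain v' l
    have a₁ := @le_right_of_mem_chain _ _ _ _ _ u l j
    have a₂ := @le_right_of_mem_chain _ _ _ _ _ u' l j
    have a₃ := @left_le_of_mem_chain _ _ _ _ _ v l j
    have a₄ := @left_le_of_mem_chain _ _ _ _ _ v' l j
    have k := key l j
    simp only [chain_compSimplex, chain_restrict, Set.mem_union, Set.mem_inter_iff, Set.mem_Icc]
    grind

section Fixes

variable {n : SimplexCategoryᵒᵖ} {p q : SimplicialThickening J}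

/-- The endomorphism `f` fixes every element of every term of the simplex `t`. -/
def Fixes (f : J →o J) (t : (p ⟶[SSet.{v}] q).obj n) : Prop :=
  ∀ l, ∀ j ∈ chain t l, f j = j

lemma Fixes.left {f : J →o J} {t : (p ⟶[SSet.{v}] q).obj n} (h : Fixes f t) : f p.as = p.as :=
  h 0 _ (left_mem_chain t 0)

lemma Fixes.right {f : J →o J} {t : (p ⟶[SSet.{v}] q).obj n} (h : Fixes f t) : f q.as = q.as :=
  h 0 _ (right_mem_chain t 0)

lemma Fixes.map {f : J →o J} {t : (p ⟶[SSet.{v}] q).obj n} (h : Fixes f t)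
    {m : SimplexCategoryᵒᵖ} (θ : n ⟶ m) : Fixes f ((p ⟶[SSet.{v}] q).map θ t) :=
  fun _ j hj ↦ h _ j hj

/-- A simplex whose terms miss a common `j ≠ i` is fixed by an endomorphism in the horn: retract
`J` onto the union of the terms. -/
lemma exists_fixes [Finite J] {i : J} (t : (p ⟶[SSet.{v}] q).obj n)
    (h : ∃ j, j ≠ i ∧ ∀ l, j ∉ chain t l) : ∃ f, InHorn i f ∧ Fixes f t := by
  obtain ⟨ρ, hρ, hρT⟩ := exists_monotone_retraction (⋃ l, chain t l)
    ⟨p.as, Set.mem_iUnion.2 ⟨0, left_mem_chain t 0⟩⟩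
  simp only [Set.mem_iUnion, forall_exists_index] at hρ hρT
  obtain ⟨j, hj, hjt⟩ := h
  refine ⟨ρ, ⟨j, hj, fun k hk ↦ ?_⟩, fun l j hj ↦ hρ j l hj⟩
  obtain ⟨l, hl⟩ := hρT k
  exact hjt l (hk ▸ hl)

end Fixes

/-! ### Diagrams indexed by an inner horn, and their values on simplices -/

variable [BoundedOrder J] {i : J}

variable (i) (S : Type u) [EnrichedCategory SSet.{v} S]

/-- What a map from the horn `Λ[n, i]` to the homotopy coherent nerve of `S` does to the simplices
of `Δ[n]` that are endomorphisms of `J = {0, …, n}`: each endomorphism `f` in the horn gives a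
simplicial functor to `S`, compatibly with precomposition. As every face of the horn is a
restriction of such an `f`, these simplices determine the map. The bounds say that the horn is
inner. -/
structure HornDiagram where
  bot_lt : ⊥ < i
  lt_top : i < ⊤
  functor (f : J →o J) (hf : InHorn i f) : EnrichedFunctor SSet.{v} (SimplicialThickening J) S
  functor_comp (f g : J →o J) (hf : InHorn i f) :
    functor (f.comp g) (hf.comp g) = (SimplicialThickening.functor g).comp SSet.{v} (functor f hf)

namespace HornDiagram

variable {i S} (H : HornDiagram i S)

/-- The object of `S` at the vertex `j`. -/
def obj (j : J) : S :=
  (H.functor _ (inHorn_const H.bot_lt H.lt_top j)).obj ⟨⊥⟩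

lemma functor_obj (f : J →o J) (hf : InHorn i f) (p : SimplicialThickening J) :
    (H.functor f hf).obj p = H.obj (f p.as) := by
  have := H.functor_comp f (OrderHom.const J p.as) hf
  exact (congrArg (fun K ↦ EnrichedFunctor.obj K ⟨⊥⟩) this).symm

/-- The action of the simplicial functor attached to `f` on a mapping space, between the objects
at the vertices `a = f p` and `b = f q`. -/
def act (f : J →o J) (hf : InHorn i f) {p q : SimplicialThickening J} {a b : J}
    (ha : f p.as = a) (hb : f q.as = b) : (p ⟶[SSet.{v}] q) ⟶ (H.obj a ⟶[SSet.{v}] H.obj b) :=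
  mapOfEq (H.functor f hf) ((H.functor_obj f hf p).trans (by rw [ha]))
    ((H.functor_obj f hf q).trans (by rw [hb]))

variable {n : SimplexCategoryᵒᵖ} {p q r : SimplicialThickening J} {a b c : J}

lemma act_id (f : J →o J) (hf : InHorn i f) (ha ha' : f p.as = a) :
    (H.act f hf ha ha').app n (idSimplex p n) = idSimplex (H.obj a) n :=
  mapOfEq_idSimplex _ _ _ _

lemma act_comp (f : J →o J) (hf : InHorn i f) (ha : f p.as = a) (hb : f q.as = b)
    (hc : f r.as = c) (s : (p ⟶[SSet.{v}] q).obj n) (t : (q ⟶[SSet.{v}] r).obj n) :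
    (H.act f hf ha hc).app n (compSimplex s t) =
      compSimplex ((H.act f hf ha hb).app n s) ((H.act f hf hb hc).app n t) :=
  mapOfEq_compSimplex _ _ _ _ _ _

lemma act_image (f g : J →o J) (hf : InHorn i f) (ha : f (g p.as) = a) (hb : f (g q.as) = b)
    (t : (p ⟶[SSet.{v}] q).obj n) :
    (H.act (f.comp g) (hf.comp g) ha hb).app n t =
      (H.act f hf (p := ⟨g p.as⟩) (q := ⟨g q.as⟩) ha hb).app n (image g t) :=
  ConcreteCategory.congr_hom (NatTrans.congr_app (mapOfEq_comp (H.functor_comp f g hf)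
    (x := H.obj a) (y := H.obj b) ((H.functor_obj _ _ p).trans (congrArg H.obj ha))
    ((H.functor_obj _ _ q).trans (congrArg H.obj hb))
    ((H.functor_obj f hf ⟨g p.as⟩).trans (congrArg H.obj ha))
    ((H.functor_obj f hf ⟨g q.as⟩).trans (congrArg H.obj hb))) n) t

/-- An extensionality principle for simplices whose endpoints are only propositionally equal. -/
lemma act_eq_of_chain_eq (f : J →o J) (hf : InHorn i f) {p' q' : SimplicialThickening J}
    (hp : p = p') (hq : q = q') (ha : f p.as = a) (hb : f q.as = b) (ha' : f p'.as = a)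
    (hb' : f q'.as = b) (t : (p ⟶[SSet.{v}] q).obj n) (t' : (p' ⟶[SSet.{v}] q').obj n)
    (h : ∀ l, chain t l = chain t' l) :
    (H.act f hf ha hb).app n t = (H.act f hf ha' hb').app n t' := by
  subst hp hq
  rw [chain_ext h]

/-- The value of the diagram on a simplex `t` depends only on the restriction of `f` to the terms
of `t`: endomorphisms agreeing there become equal after a retraction onto the union of these
terms, and that retraction does not change `t`. -/
lemma act_congr [Finite J] (f g : J →o J) (hf : InHorn i f) (hg : InHorn i g) (ha : f p.as = a)
    (hb : f q.as = b) (ha' : g p.as = a) (hb' : g q.as = b) (t : (p ⟶[SSet.{v}] q).obj n)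
    (h : ∀ l, ∀ j ∈ chain t l, f j = g j) :
    (H.act f hf ha hb).app n t = (H.act g hg ha' hb').app n t := by
  obtain ⟨ρ, hρ, hρT⟩ := exists_monotone_retraction (⋃ l, chain t l)
    ⟨p.as, Set.mem_iUnion.2 ⟨0, left_mem_chain t 0⟩⟩
  simp only [Set.mem_iUnion, forall_exists_index] at hρ hρT
  have hp : ρ p.as = p.as := hρ _ 0 (left_mem_chain t 0)
  have hq : ρ q.as = q.as := hρ _ 0 (right_mem_chain t 0)
  have key (f' : J →o J) (hf' : InHorn i f') (ha : f' p.as = a) (hb : f' q.as = b) :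
      (H.act f' hf' ha hb).app n t =
        (H.act (f'.comp ρ) (hf'.comp ρ) (p := p) (q := q) ((congrArg f' hp).trans ha)
          ((congrArg f' hq).trans hb)).app n t := by
    rw [act_image]
    refine H.act_eq_of_chain_eq _ _ ?_ ?_ _ _ _ _ _ _ fun l ↦ ?_
    · rw [hp]
    · rw [hq]
    · rw [chain_image]
      have : Set.EqOn ρ id (chain t l) := fun j hj ↦ hρ j l hj
      rw [this.image_eq, Set.image_id]
  have hfg : f.comp ρ = g.comp ρ := by
    ext j
    obtain ⟨l, hl⟩ := hρT j
    exact h l _ hl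
  rw [key f hf ha hb, key g hg ha' hb']
  simp only [hfg]

/-- The relation "`s` is the value of the diagram on `t`". It holds if `t` decomposes as `u ≫ v`
with `u` and `v` fixed by endomorphisms `f` and `g` in the horn, and `s` is the composite of the
resulting values on `u` and `v`. Taking `v` or `u` to be an identity covers simplices `t` that are
themselves fixed by an endomorphism in the horn. -/
def Val (t : (p ⟶[SSet.{v}] q).obj n) (s : (H.obj p.as ⟶[SSet.{v}] H.obj q.as).obj n) : Prop :=
  ∃ (r : SimplicialThickening J) (u : (p ⟶[SSet.{v}] r).obj n) (v : (r ⟶[SSet.{v}] q).obj n)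
    (f g : J →o J) (hf : InHorn i f) (hg : InHorn i g) (hu : Fixes f u) (hv : Fixes g v),
    t = compSimplex u v ∧
      s = compSimplex ((H.act f hf hu.left hu.right).app n u)
        ((H.act g hg hv.left hv.right).app n v)

lemma Val.map {t : (p ⟶[SSet.{v}] q).obj n} {s : (H.obj p.as ⟶[SSet.{v}] H.obj q.as).obj n}
    (h : H.Val t s) {m : SimplexCategoryᵒᵖ} (θ : n ⟶ m) :
    H.Val ((p ⟶[SSet.{v}] q).map θ t) ((H.obj p.as ⟶[SSet.{v}] H.obj q.as).map θ s) := by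
  obtain ⟨r, u, v, f, g, hf, hg, hu, hv, rfl, rfl⟩ := h
  refine ⟨r, _, _, f, g, hf, hg, hu.map θ, hv.map θ, map_compSimplex _ _ _, ?_⟩
  rw [map_compSimplex, NatTrans.naturality_apply, NatTrans.naturality_apply]

/-- Over a common refinement of two decompositions of `t`, both values are the same composite of
three simplices. -/
lemma Val.unique [Finite J] {t : (p ⟶[SSet.{v}] q).obj n}
    {s s' : (H.obj p.as ⟶[SSet.{v}] H.obj q.as).obj n}
    (h : H.Val t s) (h' : H.Val t s') : s = s' := by
  obtain ⟨r, u, v, f, g, hf, hg, hu, hv, e, rfl⟩ := h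
  obtain ⟨r', u', v', f', g', hf', hg', hu', hv', e', rfl⟩ := h'
  wlog hrr' : r.as ≤ r'.as generalizing r u v f g r' u' v' f' g'
  · exact (this r' u' v' f' g' hf' hg' hu' hv' e' r u v f g hf hg hu hv e
      (le_of_not_ge hrr')).symm
  obtain ⟨w, rfl, rfl⟩ := exists_common_refinement (e.symm.trans e') hrr'
  have hf'u : Fixes f' u := fun l j hj ↦ hu' l j (Or.inl hj)
  have hf'w : Fixes f' w := fun l j hj ↦ hu' l j (Or.inr hj)
  have hgw : Fixes g w := fun l j hj ↦ hv l j (Or.inl hj)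
  have hgv' : Fixes g v' := fun l j hj ↦ hv l j (Or.inr hj)
  rw [H.act_comp g hg _ hgw.right, H.act_comp f' hf' _ hf'u.right, compSimplex_assoc,
    H.act_congr f f' hf hf' hu.left hu.right hf'u.left hf'u.right u
      (fun l j hj ↦ (hu l j hj).trans (hf'u l j hj).symm),
    H.act_congr g f' hg hf' hgw.left hgw.right hf'w.left hf'w.right w
      (fun l j hj ↦ (hgw l j hj).trans (hf'w l j hj).symm),
    H.act_congr g g' hg hg' hgv'.left hgv'.right hv'.left hv'.right v'
      (fun l j hj ↦ (hgv' l j hj).trans (hv' l j hj).symm)]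

lemma val_act {t : (p ⟶[SSet.{v}] q).obj n} (f : J →o J) (hf : InHorn i f) (ht : Fixes f t) :
    H.Val t ((H.act f hf ht.left ht.right).app n t) := by
  have hid : Fixes f (idSimplex q n) := fun l j hj ↦ (Set.mem_singleton_iff.1 hj) ▸ ht.right
  refine ⟨q, t, idSimplex q n, f, f, hf, hf, ht, hid, (comp_idSimplex t).symm, ?_⟩
  rw [act_id, comp_idSimplex]

end HornDiagram

end CategoryTheory.SimplicialThickening

/-! ### Extending partially defined maps into a Kan complex -/

namespace SSet

open modelCategoryQuillen in
/-- A functional relation from `X` to a Kan complex `Y` that is stable under the simplicial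
operators and defined on a subcomplex `B` with anodyne inclusion contains, over `B`, the graph of
a map `X ⟶ Y`. -/
lemma exists_hom_of_relation {X Y : SSet.{v}} [KanComplex Y] (B : X.Subcomplex)
    (hB : anodyneExtensions B.ι) (R : ∀ n : SimplexCategoryᵒᵖ, X.obj n → Y.obj n → Prop)
    (hmap : ∀ {n m : SimplexCategoryᵒᵖ} (θ : n ⟶ m) (t : X.obj n) (s : Y.obj n),
      R n t s → R m (X.map θ t) (Y.map θ s))
    (huniq : ∀ (n : SimplexCategoryᵒᵖ) (t : X.obj n) (s s' : Y.obj n), R n t s → R n t s' → s = s')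
    (hdom : ∀ (n : SimplexCategoryᵒᵖ), ∀ t ∈ B.obj n, ∃ s, R n t s) :
    ∃ e : X ⟶ Y, ∀ (n : SimplexCategoryᵒᵖ), ∀ t ∈ B.obj n, R n t (e.app n t) := by
  choose φ hφ using hdom
  let g : (B : SSet.{v}) ⟶ Y :=
    { app n := ↾fun t ↦ φ n t.1 t.2
      naturality n m θ := by
        ext t
        exact huniq _ _ _ _ (hφ _ _ _) (hmap θ _ _ (hφ n t.1 t.2)) }
  have := hB (Limits.terminal.from Y) ((isFibrant_iff Y).1 inferInstance).mem
  have sq : CommSq g B.ι (Limits.terminal.from Y) (Limits.terminal.from X) := ⟨by simp⟩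
  refine ⟨sq.lift, fun n t ht ↦ ?_⟩
  have h : sq.lift.app n t = φ n t ht :=
    ConcreteCategory.congr_hom (NatTrans.congr_app sq.fac_left n) (⟨t, ht⟩ : B.obj n)
  rw [h]
  exact hφ n t ht

end SSet

/-! ### The open box in a mapping space of the simplicial thickening -/

namespace CategoryTheory.SimplicialThickening
open SimplicialCategory

variable {J : Type v} [LinearOrder J]

/-- The part of the mapping space from `p` to `q` on which a diagram indexed by the horn `Λ[n, i]`
is determined: the simplices whose terms all miss some `j ≠ i`, together with the decomposable
ones, whose terms all contain some `j` strictly between `p` and `q`. If `p` and `q` are the least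
and the greatest element, the mapping space is a cube with one coordinate for each `j` strictly
between them, and all its faces are included except the one where `i` is missing. -/
def openBox (i : J) (p q : SimplicialThickening J) : (p ⟶[SSet.{v}] q).Subcomplex where
  obj _ := Set.ofPred fun t ↦ (∃ j, j ≠ i ∧ ∀ l, j ∉ chain t l) ∨
    ∃ j, p.as < j ∧ j < q.as ∧ ∀ l, j ∈ chain t l
  map _ _ ht := ht.imp (fun ⟨j, hj, h⟩ ↦ ⟨j, hj, fun _ ↦ h _⟩)
    (fun ⟨j, hj, hj', h⟩ ↦ ⟨j, hj, hj', fun _ ↦ h _⟩)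

lemma mem_openBox_iff {i : J} {p q : SimplicialThickening J} {n : SimplexCategoryᵒᵖ}
    (t : (p ⟶[SSet.{v}] q).obj n) :
    t ∈ (openBox i p q).obj n ↔ (∃ j, j ≠ i ∧ ∀ l, j ∉ chain t l) ∨
      ∃ j, p.as < j ∧ j < q.as ∧ ∀ l, j ∈ chain t l := Iff.rfl

/-- The faces of the open box in directions other than `i`. -/
def sideBox (i : J) (p q : SimplicialThickening J) : (p ⟶[SSet.{v}] q).Subcomplex where
  obj _ := Set.ofPred fun t ↦ (∃ j, j ≠ i ∧ ∀ l, j ∉ chain t l) ∨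
    ∃ j, j ≠ i ∧ p.as < j ∧ j < q.as ∧ ∀ l, j ∈ chain t l
  map _ _ ht := ht.imp (fun ⟨j, hj, h⟩ ↦ ⟨j, hj, fun _ ↦ h _⟩)
    (fun ⟨j, hi, hj, hj', h⟩ ↦ ⟨j, hi, hj, hj', fun _ ↦ h _⟩)

variable {i : J} {p q : SimplicialThickening J} {n : SimplexCategoryᵒᵖ}

lemma mem_sideBox_iff (t : (p ⟶[SSet.{v}] q).obj n) :
    t ∈ (sideBox i p q).obj n ↔ (∃ j, j ≠ i ∧ ∀ l, j ∉ chain t l) ∨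
      ∃ j, j ≠ i ∧ p.as < j ∧ j < q.as ∧ ∀ l, j ∈ chain t l := Iff.rfl

/-- The map that replaces the `i`-th coordinate of the cube, i.e. the membership of `i` in the
terms of a simplex, by the given simplex of `Δ[1]`. -/
def setMem (hp : p.as < i) (hq : i < q.as) :
    (Δ[1] ⊗ (p ⟶[SSet.{v}] q) : SSet.{v}) ⟶ (p ⟶[SSet.{v}] q) where
  app n := ↾fun x ↦ mkChain
    (fun l ↦ (chain x.2 l \ {i}) ∪ Set.ofPred fun j ↦ j = i ∧ SSet.stdSimplex.asOrderHom x.1 l = 1)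
    (fun _ _ h ↦ Set.union_subset_union (Set.sdiff_subset_sdiff_left (chain_mono x.2 h))
      fun j hj ↦ ⟨hj.1, le_antisymm (Fin.le_last _)
        (hj.2.ge.trans ((SSet.stdSimplex.asOrderHom x.1).monotone h))⟩)
    (fun l ↦ Or.inl ⟨left_mem_chain x.2 l, hp.ne⟩)
    (fun l ↦ Or.inl ⟨right_mem_chain x.2 l, hq.ne'⟩)
    (by
      rintro l j (hj | ⟨rfl, -⟩)
      · exact ⟨left_le_of_mem_chain hj.1, le_right_of_mem_chain hj.1⟩
      · exact ⟨hp.le, hq.le⟩)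
  naturality _ _ _ := rfl

lemma mem_chain_setMem (hp : p.as < i) (hq : i < q.as)
    (x : (Δ[1] ⊗ (p ⟶[SSet.{v}] q) : SSet.{v}).obj n) (l) (j : J) :
    j ∈ chain ((setMem hp hq).app n x) l ↔
      (j ∈ chain x.2 l ∧ j ≠ i) ∨ (j = i ∧ SSet.stdSimplex.asOrderHom x.1 l = 1) := Iff.rfl

open Classical in
/-- The `i`-th coordinate of the cube: the membership of `i` in the terms of a simplex. -/
noncomputable def indicator (i : J) (p q : SimplicialThickening J) :
    (p ⟶[SSet.{v}] q) ⟶ (Δ[1] : SSet.{v}) where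
  app n := ↾fun t ↦ SSet.stdSimplex.objMk ⟨fun l ↦ if i ∈ chain t l then 1 else 0, fun l k h ↦ by
    have := @chain_mono _ _ _ _ _ t l k h i
    dsimp only
    split_ifs <;> simp_all⟩
  naturality _ _ _ := rfl

lemma asOrderHom_indicator (t : (p ⟶[SSet.{v}] q).obj n) (l) :
    SSet.stdSimplex.asOrderHom ((indicator i p q).app n t) l = 1 ↔ i ∈ chain t l := by
  classical
  change (if i ∈ chain t l then (1 : Fin 2) else 0) = 1 ↔ _
  simp

lemma mem_horn_one_iff (x : (Δ[1] : SSet.{v}).obj n) :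
    x ∈ (Λ[1, 1] : (Δ[1] : SSet.{v}).Subcomplex).obj n ↔
      ∀ l, SSet.stdSimplex.asOrderHom x l = 1 := by
  rw [SSet.mem_horn_iff, Set.ne_univ_iff_exists_notMem]
  constructor
  · rintro ⟨a, ha⟩ l
    simp only [Set.union_singleton, Set.mem_insert_iff, Set.mem_range, not_or, not_exists] at ha
    have := ha.2 l
    revert this
    have := ha.1
    generalize SSet.stdSimplex.asOrderHom x l = b
    fin_cases a <;> fin_cases b <;> simp_all
  · intro h
    exact ⟨0, by simp [h]⟩

/-- The open box inclusion is a retract of the pushout-product of the inclusion of the vertex `1`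
into `Δ[1]` and the inclusion of `sideBox`: the section adjoins the `i`-th coordinate, and the
retraction is `setMem`. -/
lemma anodyneExtensions_openBox_ι (hp : p.as < i) (hq : i < q.as) :
    SSet.anodyneExtensions (openBox i p q).ι := by
  let A : (Δ[1] ⊗ (p ⟶[SSet.{v}] q) : SSet.{v}).Subcomplex :=
    SSet.Subcomplex.unionProd Λ[1, 1] (sideBox i p q)
  have hA : SSet.anodyneExtensions A.ι :=
    SSet.anodyneExtensions_unionProd_ι' _ _ (SSet.anodyneExtensions.horn_ι 1)
  have hmem {n} (x : (Δ[1] ⊗ (p ⟶[SSet.{v}] q) : SSet.{v}).obj n) : x ∈ A.obj n ↔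
      x.2 ∈ (sideBox i p q).obj n ∨ x.1 ∈ Λ[1, 1].obj n :=
    SSet.Subcomplex.mem_unionProd_iff _ _ x
  let s : (p ⟶[SSet.{v}] q) ⟶ (Δ[1] ⊗ (p ⟶[SSet.{v}] q) : SSet.{v}) :=
    CartesianMonoidalCategory.lift (indicator i p q) (𝟙 _)
  have hs : s ≫ setMem hp hq = 𝟙 _ := by
    ext n t l j
    refine (mem_chain_setMem hp hq _ l j).trans ?_
    change (j ∈ chain t l ∧ j ≠ i) ∨
      (j = i ∧ SSet.stdSimplex.asOrderHom ((indicator i p q).app n t) l = 1) ↔ j ∈ chain t l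
    rw [asOrderHom_indicator]
    by_cases h : j = i <;> simp [h]
  have hsA {n} (t : (p ⟶[SSet.{v}] q).obj n) (ht : t ∈ (openBox i p q).obj n) :
      s.app n t ∈ A.obj n := by
    refine (hmem _).2 ?_
    change t ∈ (sideBox i p q).obj n ∨ (indicator i p q).app n t ∈ Λ[1, 1].obj n
    rw [mem_sideBox_iff, mem_horn_one_iff]
    simp only [asOrderHom_indicator]
    obtain h | ⟨j, hj, hj', h⟩ := ht
    · exact Or.inl (Or.inl h)
    · by_cases hji : j = i
      · exact Or.inr (hji ▸ h)
      · exact Or.inl (Or.inr ⟨j, hji, hj, hj', h⟩)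
  have hrA {n} (x : (Δ[1] ⊗ (p ⟶[SSet.{v}] q) : SSet.{v}).obj n) (hx : x ∈ A.obj n) :
      (setMem hp hq).app n x ∈ (openBox i p q).obj n := by
    rw [hmem, mem_sideBox_iff, mem_horn_one_iff] at hx
    simp only [mem_openBox_iff, mem_chain_setMem]
    obtain (⟨j, hj, h⟩ | ⟨j, hji, hj, hj', h⟩) | h := hx
    · exact Or.inl ⟨j, hj, fun l ↦ by simp [h, hj]⟩
    · exact Or.inr ⟨j, hj, hj', fun l ↦ Or.inl ⟨h l, hji⟩⟩
    · exact Or.inr ⟨i, hp, hq, fun l ↦ Or.inr ⟨rfl, h l⟩⟩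
  refine MorphismProperty.of_retract (P := SSet.anodyneExtensions) (f := (openBox i p q).ι)
    (g := A.ι) ?_ hA
  refine
    { i := Arrow.homMk (SSet.Subcomplex.lift ((openBox i p q).ι ≫ s) ?_) s rfl
      r := Arrow.homMk (SSet.Subcomplex.lift (A.ι ≫ setMem hp hq) ?_) (setMem hp hq) rfl
      retract := ?_ }
  · rintro n _ ⟨t, rfl⟩
    exact hsA _ t.2
  · rintro n _ ⟨t, rfl⟩
    exact hrA _ t.2
  · ext : 1
    · rw [← cancel_mono (openBox i p q).ι]
      exact congrArg ((openBox i p q).ι ≫ ·) hs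
    · exact hs

lemma openBox_eq_top [BoundedOrder J] (h₀ : ⊥ < i) (h₁ : i < ⊤) (h : ¬ (p.as < i ∧ i < q.as)) :
    openBox i p q = ⊤ := by
  ext n t
  simp only [mem_openBox_iff, Subfunctor.top_obj, Set.top_eq_univ, Set.mem_univ, iff_true]
  left
  by_cases hp : p.as < i
  · exact ⟨⊤, h₁.ne', fun l hl ↦ h ⟨hp, h₁.trans_le (le_right_of_mem_chain hl)⟩⟩
  · exact ⟨⊥, h₀.ne, fun l hl ↦ hp ((left_le_of_mem_chain hl).trans_lt h₀)⟩

/-! ### Extension of a diagram indexed by an inner horn -/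

namespace HornDiagram

variable [BoundedOrder J] {S : Type u} [EnrichedCategory SSet.{v} S] (H : HornDiagram i S)

/-- Together with `exists_val`, this identifies the open box with the domain of the relation
`Val`. -/
lemma mem_openBox_of_val {t : (p ⟶[SSet.{v}] q).obj n}
    {s : (H.obj p.as ⟶[SSet.{v}] H.obj q.as).obj n} (h : H.Val t s) :
    t ∈ (openBox i p q).obj n := by
  obtain ⟨r, u, v, f, g, hf, hg, hu, hv, rfl, -⟩ := h
  rw [mem_openBox_iff]
  obtain hpr | hpr := (le_of_simplex u).lt_or_eq
  · obtain hrq | hrq := (le_of_simplex v).lt_or_eq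
    · exact Or.inr ⟨r.as, hpr, hrq, fun l ↦ Or.inl (right_mem_chain u l)⟩
    · obtain ⟨j, hj, hjf⟩ := hf
      have hju (l) : j ∉ chain u l := fun hl ↦ hjf j (hu l j hl)
      refine Or.inl ⟨j, hj, fun l hl ↦ hl.elim (hju l) fun hl ↦ hju l ?_⟩
      rw [le_antisymm ((le_right_of_mem_chain hl).trans hrq.ge) (left_le_of_mem_chain hl)]
      exact right_mem_chain u l
  · obtain ⟨j, hj, hjg⟩ := hg
    have hjv (l) : j ∉ chain v l := fun hl ↦ hjg j (hv l j hl)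
    refine Or.inl ⟨j, hj, fun l hl ↦ hl.elim (fun hl ↦ hjv l ?_) (hjv l)⟩
    rw [le_antisymm (le_right_of_mem_chain hl) (hpr.ge.trans (left_le_of_mem_chain hl))]
    exact left_mem_chain v l

variable [Finite J]

lemma exists_val {t : (p ⟶[SSet.{v}] q).obj n} (ht : t ∈ (openBox i p q).obj n) :
    ∃ s, H.Val t s := by
  obtain h | ⟨j, hj, hj', h⟩ := ht
  · obtain ⟨f, hf, hft⟩ := exists_fixes t h
    exact ⟨_, H.val_act f hf hft⟩
  · obtain ⟨f, hf, hu⟩ := exists_fixes (i := i) (restrict t p ⟨j⟩ hj.le (left_mem_chain t) h)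
      ⟨⊤, H.lt_top.ne', fun l hl ↦ (hj'.trans_le le_top).not_ge (le_right_of_mem_chain hl)⟩
    obtain ⟨g, hg, hv⟩ := exists_fixes (i := i) (restrict t ⟨j⟩ q hj'.le h (right_mem_chain t))
      ⟨⊥, H.bot_lt.ne, fun l hl ↦ (bot_le.trans_lt hj).not_ge (left_le_of_mem_chain hl)⟩
    exact ⟨_, ⟨j⟩, _, _, f, g, hf, hg, hu, hv, (compSimplex_restrict t ⟨j⟩ hj.le hj'.le h).symm,
      rfl⟩

/-- The values of the diagram extend from the open box to the whole mapping space. When `i` does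
not lie strictly between `p` and `q`, the open box is everything; otherwise its inclusion is
anodyne. -/
lemma exists_extension_hom (hS : ∀ x y : S, SSet.KanComplex (x ⟶[SSet.{v}] y))
    (p q : SimplicialThickening J) :
    ∃ e : (p ⟶[SSet.{v}] q) ⟶ (H.obj p.as ⟶[SSet.{v}] H.obj q.as),
      ∀ (n : SimplexCategoryᵒᵖ) (t : (p ⟶[SSet.{v}] q).obj n) s, H.Val t s → e.app n t = s := by
  have hB : SSet.anodyneExtensions (openBox i p q).ι := by
    by_cases h : p.as < i ∧ i < q.as
    · exact anodyneExtensions_openBox_ι h.1 h.2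
    · rw [openBox_eq_top H.bot_lt H.lt_top h]
      exact .of_isIso _
  have := hS (H.obj p.as) (H.obj q.as)
  obtain ⟨e, he⟩ := SSet.exists_hom_of_relation (openBox i p q) hB (fun _ ↦ H.Val)
    (fun θ _ _ h ↦ h.map H θ) (fun _ _ _ _ h h' ↦ h.unique H h') (fun _ _ ht ↦ H.exists_val ht)
  exact ⟨e, fun n t s h ↦ (he n t (H.mem_openBox_of_val h)).unique H h⟩

/-- A diagram indexed by an inner horn in a category with Kan mapping spaces extends to a
simplicial functor on the whole simplicial thickening. -/
theorem exists_extension (hS : ∀ x y : S, SSet.KanComplex (x ⟶[SSet.{v}] y)) :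
    ∃ E : EnrichedFunctor SSet.{v} (SimplicialThickening J) S, ∀ (f : J →o J) (hf : InHorn i f),
      H.functor f hf = (SimplicialThickening.functor f).comp SSet.{v} E := by
  choose e he using H.exists_extension_hom hS
  have he' {p q : SimplicialThickening J} {n} (t : (p ⟶[SSet.{v}] q).obj n) (f : J →o J)
      (hf : InHorn i f) (ht : Fixes f t) :
      (e p q).app n t = (H.act f hf ht.left ht.right).app n t :=
    he p q n t _ (H.val_act f hf ht)
  have hid (p : SimplicialThickening J) (n : SimplexCategoryᵒᵖ) :
      (e p p).app n (idSimplex p n) = idSimplex (H.obj p.as) n := by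
    have hfix : Fixes (OrderHom.const J p.as) (idSimplex p n) := fun l j hj ↦
      (Set.mem_singleton_iff.1 hj).symm
    rw [he' _ _ (inHorn_const H.bot_lt H.lt_top p.as) hfix, act_id]
  have hcomp (p q r : SimplicialThickening J) (n : SimplexCategoryᵒᵖ)
      (s : (p ⟶[SSet.{v}] q).obj n) (t : (q ⟶[SSet.{v}] r).obj n) :
      (e p r).app n (compSimplex s t) =
        compSimplex ((e p q).app n s) ((e q r).app n t) := by
    obtain hpq | hpq := (le_of_simplex s).lt_or_eq
    · obtain hqr | hqr := (le_of_simplex t).lt_or_eq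
      -- `s` misses the greatest element and `t` the least, so each is fixed by an endomorphism
      -- in the horn and `e` has the prescribed value on their composite.
      · obtain ⟨f, hf, hs⟩ := exists_fixes (i := i) s
          ⟨⊤, H.lt_top.ne', fun l hl ↦ (hqr.trans_le le_top).not_ge (le_right_of_mem_chain hl)⟩
        obtain ⟨g, hg, ht⟩ := exists_fixes (i := i) t
          ⟨⊥, H.bot_lt.ne, fun l hl ↦ (bot_le.trans_lt hpq).not_ge (left_le_of_mem_chain hl)⟩
        rw [he' s f hf hs, he' t g hg ht]
        exact he p r n _ _ ⟨q, s, t, f, g, hf, hg, hs, ht, rfl, rfl⟩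
      · obtain rfl : q = r := by cases q; cases r; exact congrArg _ hqr
        rw [eq_idSimplex t, hid, comp_idSimplex, comp_idSimplex]
    · obtain rfl : p = q := by cases p; cases q; exact congrArg _ hpq
      rw [eq_idSimplex s, hid, idSimplex_comp, idSimplex_comp]
  refine ⟨enrichedFunctorMk (fun p ↦ H.obj p.as) e hid hcomp, fun f hf ↦ ?_⟩
  refine EnrichedFunctor.ext _ (fun p ↦ H.functor_obj f hf p) fun p q ↦ ?_
  ext n t
  change (H.act f hf (p := p) (q := q) rfl rfl).app n t = (e _ _).app n (image f t)
  obtain ⟨g, hg, ht⟩ := exists_fixes (i := i) (image f t) (by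
    obtain ⟨j, hj, hjf⟩ := hf
    refine ⟨j, hj, fun l ↦ ?_⟩
    rw [chain_image]
    rintro ⟨k, -, hk⟩
    exact hjf k hk)
  rw [he' _ g hg ht, ← H.act_image g f hg ht.left ht.right t]
  exact H.act_congr _ _ _ _ _ _ _ _ _ fun l j hj ↦ (ht l _ ⟨j, hj, rfl⟩).symm

end HornDiagram

end CategoryTheory.SimplicialThickening

/-! ### Filling inner horns in the homotopy coherent nerve -/

namespace CategoryTheory.SimplicialNerve
open SimplicialThickening

variable {S : Type u} [Category.{v} S] [SimplicialCategory S] {N : ℕ}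

/-- The morphism of the simplex category underlying a monotone endomorphism of `{0, …, N}`, lifted
to the universe of the simplicial thickening. -/
def endoHom (f : ULift.{v} (Fin (N + 1)) →o ULift.{v} (Fin (N + 1))) : ⦋N⦌ ⟶ ⦋N⦌ :=
  SimplexCategory.Hom.mk ⟨fun k ↦ (f ⟨k⟩).down, fun _ _ h ↦ f.monotone h⟩

/-- A monotone endomorphism of `{0, …, N}` as an `N`-simplex of `Δ[N]`. -/
def endoSimplex (f : ULift.{v} (Fin (N + 1)) →o ULift.{v} (Fin (N + 1))) :
    (Δ[N] : SSet.{max u v}) _⦋N⦌ :=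
  SSet.stdSimplex.objEquiv.symm (endoHom f)

lemma endoSimplex_mem_horn {k : Fin (N + 1)}
    {f : ULift.{v} (Fin (N + 1)) →o ULift.{v} (Fin (N + 1))} (hf : InHorn ⟨k⟩ f) :
    endoSimplex.{v, u} f ∈ Λ[N, k].obj _ := by
  rw [SSet.mem_horn_iff_notMem_range]
  obtain ⟨⟨j⟩, hj, h⟩ := hf
  refine ⟨j, fun e ↦ hj (congrArg _ e), ?_⟩
  rintro ⟨l, hl⟩
  exact h ⟨l⟩ (congrArg ULift.up hl)

/-- The diagram of simplicial functors given by a map from an inner horn to the homotopy coherent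
nerve. -/
def hornDiagram {k : Fin (N + 1)} (h₀ : 0 < k) (h₁ : k < Fin.last N)
    (σ : (Λ[N, k] : SSet.{max u v}) ⟶ SimplicialNerve S) :
    HornDiagram (⟨k⟩ : ULift.{v} (Fin (N + 1))) S where
  bot_lt := h₀
  lt_top := h₁
  functor f hf := σ.app (op ⦋N⦌) ⟨endoSimplex f, endoSimplex_mem_horn hf⟩
  functor_comp f g hf :=
    NatTrans.naturality_apply σ (endoHom g).op
      (⟨endoSimplex f, endoSimplex_mem_horn hf⟩ : Λ[N, k].obj (op ⦋N⦌))

end CategoryTheory.SimplicialNerve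

open SimplicialThickening in
theorem mainTheorem2 (S : Type u) [CategoryTheory.Category.{v} S]
    [CategoryTheory.SimplicialCategory S]
    (hKan : ∀ X Y : S, SSet.KanComplex (CategoryTheory.SimplicialCategory.sHom X Y)) :
    SSet.Quasicategory (CategoryTheory.SimplicialNerve S) := by
  refine SSet.quasicategory_of_filler _ fun n k σ h₀ h₁ ↦ ?_
  obtain ⟨E, hE⟩ := (SimplicialNerve.hornDiagram h₀ h₁ σ).exists_extension hKan
  refine ⟨E, fun j hj ↦ ?_⟩
  -- The `j`-th face of the horn is the restriction along `δ j` of a retraction onto the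
  -- complement of `j`, which is an endomorphism in the horn.
  obtain ⟨ρ, hρ, hρj⟩ := exists_monotone_retraction
    ({⟨j⟩}ᶜ : Set (ULift.{v} (Fin (n + 2 + 1)))) ⟨⟨k⟩, fun h ↦ hj (congrArg ULift.down h).symm⟩
  have hρk : InHorn ⟨k⟩ ρ := ⟨⟨j⟩, fun h ↦ hj (congrArg ULift.down h), hρj⟩
  have hδ : SimplexCategory.δ j ≫ SimplicialNerve.endoHom ρ = SimplexCategory.δ j := by
    ext l : 3
    exact congrArg ULift.down (hρ ⟨j.succAbove l⟩ fun h ↦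
      Fin.succAbove_ne j l (congrArg ULift.down h))
  have hface : SSet.horn.face.{max u v} k j hj = (Λ[n + 2, k] : SSet.{max u v}).δ j
      (⟨_, SimplicialNerve.endoSimplex_mem_horn.{v, u} hρk⟩ : Λ[n + 2, k].obj (op ⦋n + 2⦌)) := by
    apply Subtype.ext
    exact (congrArg SSet.stdSimplex.objEquiv.symm hδ).symm
  have hval : σ.app _ (⟨_, SimplicialNerve.endoSimplex_mem_horn.{v, u} hρk⟩ :
      Λ[n + 2, k].obj (op ⦋n + 2⦌)) =
      (CategoryTheory.SimplicialNerve S).map (SimplicialNerve.endoHom ρ).op E := hE ρ hρk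
  rw [hface]
  refine Eq.trans ?_ (NatTrans.naturality_apply σ (SimplexCategory.δ j).op
      (⟨_, SimplicialNerve.endoSimplex_mem_horn.{v, u} hρk⟩ : Λ[n + 2, k].obj (op ⦋n + 2⦌))).symm
  rw [hval]
  change _ = ((CategoryTheory.SimplicialNerve S).map (SimplicialNerve.endoHom ρ).op ≫
    (CategoryTheory.SimplicialNerve S).map (SimplexCategory.δ j).op) E
  rw [← Functor.map_comp, ← op_comp, hδ]
  rfl
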